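/- Let $n\ge 1$ be an integer and let $HC(n)$ be the honeycomb network formed by a central hexagon and the $n-1$ rings of hexagons around it. In each hexagon of $HC(n)$ draw the hexagram (six-pointed star) whose tips are the midpoints of the six sides, place vertices at all tips and at all crossings of the hexagrams (a tip on a side common to two hexagons is a single vertex), and delete the honeycomb; the result, the dominating oxide network, consists of six triangles per hexagon. Its vertices are called oxide vertices. In each of these triangles, with corners $a,b,c$, insert three new vertices, one for each of the pairs $\{a,b\},\{b,c\},\{c,a\}$, join each new vertex to the two corners of its pair, and join the three new vertices with one another (so that each triangle becomes a planar octahedron). The resulting graph is the dominating planar octahedron network $DPOH(n)$. For a finite simple graph $G$ let $\deg(u)$ be the degree of $u$, let $S_u=\sum_{v\in N_G(u)}\deg(v)$, and put $$ABC(G)=\sum_{uv\in E(G)}\sqrt{\frac{\deg(u)+\deg(v)-2}{\deg(u)\deg(v)}},\qquad GA(G)=\sum_{uv\in E(G)}\frac{2\sqrt{\deg(u)\deg(v)}}{\deg(u)+\deg(v)},$$ $$ABC_4(G)=\sum_{uv\in E(G)}\sqrt{\frac{S_u+S_v-2}{S_uS_v}},\qquad GA_5(G)=\sum_{uv\in E(G)}\frac{2\sqrt{S_uS_v}}{S_u+S_v}.$$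 **Theorem.** Let $G\cong DPOH(n)$. Then, for $n\ge1$, $$ABC(G)=\tfrac18\Big(72\sqrt5\,(1-3n+3n^2)+6\sqrt{14}\,(5-13n+9n^2)+12\sqrt6\,(1-5n+9n^2)\Big),$$ $$GA(G)=12(3+2\sqrt2)(1-3n+3n^2),$$ and, for $n\ge3$, $$\begin{aligned}ABC_4(G)=\tfrac1{440}\Big(&66\sqrt{78}+5280(n-1)+120\sqrt{330}(n-1)+24\sqrt{2255}(n-1)+24\sqrt{3410}(n-1)\\&+264\sqrt{29}\,n+88\sqrt{930}\,n+528\sqrt{35}(2n-1)+132\sqrt{38}(2n-1)\\&+330\sqrt{46}(2-5n+3n^2)+55\sqrt{94}(10-19n+9n^2)+220\sqrt{35}(8-17n+9n^2)\Big),\end{aligned}$$ $$\begin{aligned}GA_5(G)=\;&96+\tfrac{96}{23}\sqrt{33}(n-1)+\tfrac32\sqrt{55}(n-1)+\tfrac{96}{17}\sqrt{66}(n-1)+\tfrac87\sqrt{110}(n-1)\\&-192n+8\sqrt2\,n+6\sqrt{15}\,n+108n^2+\tfrac{48}{11}\sqrt{30}(2n-1)+8\sqrt2(8-17n+9n^2).\end{aligned}$$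 -/

import Mathlib

/-! ### Degree based indices of a finite simple graph -/

namespace SimpleGraph

variable {V : Type*} (G : SimpleGraph V) [Fintype V] [DecidableEq V] [DecidableRel G.Adj]

/-- The sum `∑_{uv ∈ E(G)} f(u, v)` of a symmetric function over the (unordered) edges. -/
def edgeSum (f : V → V → ℝ) (hf : ∀ u v, f u v = f v u) : ℝ :=
  ∑ e ∈ G.edgeFinset, Sym2.lift ⟨f, hf⟩ e

/-- `S_u`, the sum of the degrees of the neighbours of `u`. -/
def neighborDegreeSum (u : V) : ℕ := ∑ v ∈ G.neighborFinset u, G.degree v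

/-- The atom-bond connectivity index, `∑_{uv} √((d_u + d_v - 2) / (d_u d_v))`. -/
noncomputable def ABC : ℝ :=
  G.edgeSum
    (fun u v => √(((G.degree u : ℝ) + G.degree v - 2) / ((G.degree u : ℝ) * G.degree v)))
    (fun u v => by
      rw [add_comm (G.degree u : ℝ), mul_comm (G.degree u : ℝ)])

/-- The geometric-arithmetic index, `∑_{uv} 2√(d_u d_v) / (d_u + d_v)`. -/
noncomputable def GA : ℝ :=
  G.edgeSum
    (fun u v => 2 * √((G.degree u : ℝ) * G.degree v) / ((G.degree u : ℝ) + G.degree v))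
    (fun u v => by
      rw [add_comm (G.degree u : ℝ), mul_comm (G.degree u : ℝ)])

/-- The fourth atom-bond connectivity index, `∑_{uv} √((S_u + S_v - 2) / (S_u S_v))`. -/
noncomputable def ABC4 : ℝ :=
  G.edgeSum
    (fun u v => √(((G.neighborDegreeSum u : ℝ) + G.neighborDegreeSum v - 2) /
      ((G.neighborDegreeSum u : ℝ) * G.neighborDegreeSum v)))
    (fun u v => by
      rw [add_comm (G.neighborDegreeSum u : ℝ), mul_comm (G.neighborDegreeSum u : ℝ)])

/-- The fifth geometric-arithmetic index, `∑_{uv} 2√(S_u S_v) / (S_u + S_v)`. -/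
noncomputable def GA5 : ℝ :=
  G.edgeSum
    (fun u v => 2 * √((G.neighborDegreeSum u : ℝ) * G.neighborDegreeSum v) /
      ((G.neighborDegreeSum u : ℝ) + G.neighborDegreeSum v))
    (fun u v => by
      rw [add_comm (G.neighborDegreeSum u : ℝ), mul_comm (G.neighborDegreeSum u : ℝ)])

end SimpleGraph

/-! ### The dominating planar octahedron network

Points of the plane are written in the basis of two lattice vectors of equal length that enclose
an angle of 60 degrees. The honeycomb network `HC(n)` is a central hexagon with `n - 1` rings of
hexagons around it; the hexagon with index `c` is centred at the point `6 c`, so that the midpoints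
of its six sides are the points `6 c + 3 d` with `d` one of the six unit vectors.

The dominating oxide network arises from `HC(n)` by drawing in each hexagon the hexagram
whose tips are the six midpoints of the sides, putting vertices at the tips and at the crossings,
and deleting the honeycomb. It consists of six triangles per hexagon, one at each tip. The
dominating silicate network has in addition a silicon vertex in each of these triangles, joined to
its three corners, the oxide vertices; a triangle with its silicon vertex is a silicate cell.
The drawing algorithm of planar octahedron networks, applied to this silicate network, puts a new
vertex in each triangular face `silicon, oxide, oxide`, joins it to the two oxide vertices of the
face, joins the three new vertices of each cell with one another, and removes silicon. -/

namespace DPOH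

/-- The six unit vectors of the triangular lattice, in cyclic order. -/
def dir : Fin 6 → ℤ × ℤ := ![(1, 0), (0, 1), (-1, 1), (-1, 0), (0, -1), (1, -1)]

/-- The indices of the hexagons of `HC(n)`: those at lattice distance less than `n` from `0`. -/
noncomputable def hexagons (n : ℕ) : Finset (ℤ × ℤ) :=
  {c ∈ Finset.Ioo (-(n : ℤ)) n ×ˢ Finset.Ioo (-(n : ℤ)) n |
    -(n : ℤ) < c.1 + c.2 ∧ c.1 + c.2 < (n : ℤ)}

/-- The silicate cells: six for each hexagon, one at the midpoint of each of its sides. -/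
abbrev Cell (n : ℕ) : Type := {c : ℤ × ℤ // c ∈ hexagons n} × Fin 6

/-- The three oxide vertices of a silicate cell, as points of the plane: a tip of the hexagram
(the midpoint of a side of the hexagon) and the two neighbouring crossings. -/
def corner {n : ℕ} (t : Cell n) : Fin 3 → ℤ × ℤ :=
  ![6 • t.1.1 + 3 • dir t.2,
    6 • t.1.1 + dir t.2 + dir (t.2 + 1),
    6 • t.1.1 + dir t.2 + dir (t.2 - 1)]

/-- The oxide vertices: all points that are a corner of some cell. Hexagons with a common side share
the tip at its midpoint, and adjacent triangles of a hexagram share a crossing. -/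
abbrev Oxide (n : ℕ) : Type :=
  {p : ℤ × ℤ // p ∈ Finset.univ.image fun q : Cell n × Fin 3 => corner q.1 q.2}

/-- The dominating oxide network: two oxide vertices are adjacent when they are distinct corners of
one triangle. -/
def oxideNetwork (n : ℕ) : SimpleGraph (Oxide n) where
  Adj p q := p ≠ q ∧ ∃ t : Cell n, (∃ j, corner t j = p.1) ∧ ∃ k, corner t k = q.1
  symm := ⟨fun _ _ h => ⟨h.1.symm, h.2.imp fun _ ht => ⟨ht.2, ht.1⟩⟩⟩
  loopless := ⟨fun _ h => h.1 rfl⟩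

/-- The vertices of `DPOH(n)`: the oxide vertices, and one new vertex `(t, j)` for each face of each
cell `t`, namely the face spanned by silicon and the two corners of `t` other than corner `j`. -/
abbrev Vertex (n : ℕ) : Type := Oxide n ⊕ (Cell n × Fin 3)

/-- Adjacency in `DPOH(n)`. -/
def Adj (n : ℕ) : Vertex n → Vertex n → Prop
  | .inl p, .inl q => (oxideNetwork n).Adj p q
  | .inl p, .inr f => ∃ k, k ≠ f.2 ∧ corner f.1 k = p.1
  | .inr f, .inl p => ∃ k, k ≠ f.2 ∧ corner f.1 k = p.1
  | .inr f, .inr g => f.1 = g.1 ∧ f.2 ≠ g.2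

/-- The dominating planar octahedron network `DPOH(n)`. -/
def network (n : ℕ) : SimpleGraph (Vertex n) where
  Adj := Adj n
  symm := ⟨by
    rintro (p | f) (q | g) h
    · exact SimpleGraph.Adj.symm (G := oxideNetwork n) h
    · exact h
    · exact h
    · exact ⟨h.1.symm, h.2.symm⟩⟩
  loopless := ⟨by
    rintro (p | f) h
    · exact h.1 rfl
    · exact h.2 rfl⟩

end DPOH

/-! The network is an edge-disjoint union of octahedra, one per cell: two distinct cells share at
most one corner, so every edge lies in exactly one octahedron (`exists_octVertex_of_adj`,
`eq_of_octVertex_eq`). Hence an edge sum is half a sum over cells of ordered adjacent pairs in a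
fixed octahedron (`DPOH.two_mul_edgeSum`).

A vertex has degree 4 times the number of octahedra through it: one for a new vertex, two for a
crossing, and for a tip two or one according as its side is shared by two hexagons. Degree sums at a
crossing also involve the tips of both its cells. So all data of a cell depend on three Booleans,
telling whether the tips of the previous cell, the cell itself and the next one are inner.

It remains to count cells by these Booleans (`sum_cells`). Rotation by 60 degrees reduces this to
one direction, where the hexagons split into one boundary corner, four boundary pieces of size `n -
1`, and a remainder with all three neighbours. This gives the edge partitions `edgeSum_degree` and
`edgeSum_neighborDegreeSum`, into which the four weights are substituted. -/

namespace SimpleGraph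

/-! ### Edge sums as sums over ordered pairs, and their invariance under isomorphism. -/

variable {V W : Type*} [Fintype V] [Fintype W]

/-- Both sides are the sum over darts: each edge carries two darts, and a dart is a vertex with a
chosen neighbour. -/
theorem two_mul_edgeSum [DecidableEq V] (G : SimpleGraph V) [DecidableRel G.Adj] (f : V → V → ℝ)
    (hf : ∀ u v, f u v = f v u) :
    2 * G.edgeSum f hf = ∑ u, ∑ v ∈ G.neighborFinset u, f u v := by
  have hdart : ∑ d : G.Dart, f d.fst d.snd = ∑ u, ∑ v ∈ G.neighborFinset u, f u v := by
    rw [Finset.sum_sigma']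
    refine Finset.sum_bij' (fun d _ => ⟨d.fst, d.snd⟩)
      (fun p h => ⟨(p.1, p.2), by simpa using h⟩) ?_ ?_ ?_ ?_ ?_ <;> simp
  rw [← hdart, ← Finset.sum_fiberwise_of_maps_to (s := Finset.univ) (t := G.edgeFinset)
    (g := Dart.edge) (fun d _ => by rw [mem_edgeFinset]; exact d.edge_mem),
    edgeSum, Finset.mul_sum]
  refine Finset.sum_congr rfl fun e he => ?_
  have hconst : ∀ d ∈ (Finset.univ.filter fun d : G.Dart => d.edge = e),
      f d.fst d.snd = Sym2.lift ⟨f, hf⟩ e := by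
    intro d hd
    rw [← (Finset.mem_filter.1 hd).2]
    rfl
  rw [Finset.sum_congr rfl hconst, Finset.sum_const,
    G.dart_edge_fiber_card e (mem_edgeFinset.1 he)]
  simp

variable {G : SimpleGraph V} {H : SimpleGraph W} [DecidableRel G.Adj] [DecidableRel H.Adj]

theorem Iso.sum_neighborFinset {M : Type*} [AddCommMonoid M] (e : G ≃g H) (u : V) (g : W → M) :
    ∑ v ∈ G.neighborFinset u, g (e v) = ∑ w ∈ H.neighborFinset (e u), g w :=
  Finset.sum_bij (fun v _ => e v) (fun v hv => by simpa [e.map_adj_iff] using hv)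
    (fun _ _ _ _ h => e.injective h)
    (fun w hw => ⟨e.symm w, by simpa [← e.map_adj_iff] using hw, by simp⟩) fun _ _ => rfl

theorem Iso.neighborDegreeSum_eq [DecidableEq V] [DecidableEq W] (e : G ≃g H) (u : V) :
    H.neighborDegreeSum (e u) = G.neighborDegreeSum u := by
  rw [neighborDegreeSum, neighborDegreeSum, ← e.sum_neighborFinset]
  exact Finset.sum_congr rfl fun v _ => e.degree_eq v

theorem Iso.edgeSum_eq [DecidableEq V] [DecidableEq W] (e : G ≃g H) {f : V → V → ℝ} {f' : W → W → ℝ}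
    {hf : ∀ u v, f u v = f v u} {hf' : ∀ u v, f' u v = f' v u}
    (h : ∀ u v, f u v = f' (e u) (e v)) : G.edgeSum f hf = H.edgeSum f' hf' := by
  have h2 : 2 * G.edgeSum f hf = 2 * H.edgeSum f' hf' := by
    rw [two_mul_edgeSum, two_mul_edgeSum, ← e.toEquiv.sum_comp]
    refine Finset.sum_congr rfl fun u _ => ?_
    simp only [h]
    exact e.sum_neighborFinset u (f' (e u))
  linarith

end SimpleGraph

/-! ### Cells and the coincidences among their corners. -/

namespace DPOH

variable {n : ℕ}

theorem corner_mem (t : Cell n) (j : Fin 3) :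
    corner t j ∈ Finset.univ.image fun q : Cell n × Fin 3 => corner q.1 q.2 :=
  Finset.mem_image_of_mem _ (Finset.mem_univ (t, j))

/-- The six vertices of the octahedron of a cell: its corners, and its new vertices. -/
def octVertex (t : Cell n) : Fin 3 ⊕ Fin 3 → Vertex n
  | .inl j => .inl ⟨corner t j, corner_mem t j⟩
  | .inr j => .inr (t, j)

/-- The octahedron graph; the antipode of corner `j` is the new vertex `j`. -/
def octAdj (x y : Fin 3 ⊕ Fin 3) : Prop := x ≠ y ∧ x ≠ y.swap

instance : DecidableRel octAdj := fun _ _ => inferInstanceAs (Decidable (_ ∧ _))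

/-- The position of a corner of a cell relative to the centre of its hexagon. -/
def offset (i : Fin 6) : Fin 3 → ℤ × ℤ :=
  ![3 • dir i, dir i + dir (i + 1), dir i + dir (i - 1)]

theorem corner_eq (t : Cell n) (j : Fin 3) : corner t j = 6 • t.1.1 + offset t.2 j := by
  fin_cases j <;> simp [corner, offset, add_assoc]

/-- Hexagon centres lie in 6ℤ², so equal corners have offsets congruent modulo 6. This turns the
classification of coincidences into a finite check. -/
theorem offset_congr : ∀ (i i' : Fin 6) (j j' : Fin 3),
    6 ∣ (offset i j - offset i' j').1 → 6 ∣ (offset i j - offset i' j').2 →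
      (i' = i ∧ j' = j) ∨ (i' = i + 3 ∧ j = 0 ∧ j' = 0) ∨
      (i' = i + 1 ∧ j = 1 ∧ j' = 2) ∨ (i' = i - 1 ∧ j = 2 ∧ j' = 1) := by
  decide

theorem offset_add_three : ∀ i : Fin 6, offset (i + 3) 0 = offset i 0 - 6 • dir i := by
  decide

theorem offset_next : ∀ i : Fin 6, offset (i + 1) 2 = offset i 1 := by
  decide

theorem offset_prev : ∀ i : Fin 6, offset (i - 1) 1 = offset i 2 := by
  decide

theorem corner_eq_corner_iff (t t' : Cell n) (j j' : Fin 3) :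
    corner t j = corner t' j' ↔
      (t' = t ∧ j' = j) ∨
      (t'.1.1 = t.1.1 + dir t.2 ∧ t'.2 = t.2 + 3 ∧ j = 0 ∧ j' = 0) ∨
      (t' = (t.1, t.2 + 1) ∧ j = 1 ∧ j' = 2) ∨ (t' = (t.1, t.2 - 1) ∧ j = 2 ∧ j' = 1) := by
  obtain ⟨⟨c, hc⟩, i⟩ := t
  obtain ⟨⟨c', hc'⟩, i'⟩ := t'
  simp only [corner_eq, Prod.mk.injEq, Subtype.mk.injEq]
  constructor
  · intro h
    have h1 := congrArg Prod.fst h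
    have h2 := congrArg Prod.snd h
    simp only [Prod.fst_add, Prod.snd_add, Prod.smul_fst, Prod.smul_snd] at h1 h2
    simp only [nsmul_eq_mul, Nat.cast_ofNat] at h1 h2
    -- Equal offsets force equal centres; only in the opposite-tip case do the offsets differ, by `6
    -- • dir i`, which moves to the adjacent hexagon.
    have hcancel : offset i j = offset i' j' → c' = c := by
      intro he
      rw [he] at h1 h2
      exact Prod.ext (by omega) (by omega)
    rcases offset_congr i i' j j' ⟨c'.1 - c.1, by simp only [Prod.fst_sub]; omega⟩
      ⟨c'.2 - c.2, by simp only [Prod.snd_sub]; omega⟩ with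
      ⟨rfl, rfl⟩ | ⟨rfl, rfl, rfl⟩ | ⟨rfl, rfl, rfl⟩ | ⟨rfl, rfl, rfl⟩
    · simp [hcancel rfl]
    · refine .inr (.inl ⟨?_, rfl, rfl, rfl⟩)
      rw [offset_add_three] at h1 h2
      simp only [Prod.fst_sub, Prod.snd_sub, Prod.smul_fst, Prod.smul_snd] at h1 h2
      simp only [nsmul_eq_mul, Nat.cast_ofNat] at h1 h2
      exact Prod.ext (by simp only [Prod.fst_add]; omega) (by simp only [Prod.snd_add]; omega)
    · simp [hcancel (offset_next i).symm]
    · simp [hcancel (offset_prev i).symm]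
  · rintro (⟨⟨rfl, rfl⟩, rfl⟩ | ⟨rfl, rfl, rfl, rfl⟩ | ⟨⟨rfl, rfl⟩, rfl, rfl⟩ |
      ⟨⟨rfl, rfl⟩, rfl, rfl⟩)
    · rfl
    · rw [offset_add_three, smul_add]; abel
    · rw [offset_next]
    · rw [offset_prev]

theorem corner_injective (t : Cell n) : Function.Injective (corner t) := by
  intro j k h
  rcases (corner_eq_corner_iff t t j k).1 h with h | h | h | h
  · exact h.2.symm
  · exact h.2.2.1.trans h.2.2.2.symm
  · have := congrArg Prod.snd h.1
    simp at this
  · have := congrArg Prod.snd h.1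
    simp [sub_eq_add_neg] at this

/-- A different cell sharing a corner with `t` has direction `i + 3`, `i + 1` or `i - 1`, according
to which corner is shared. These directions are distinct, so two different corners cannot lead to
the same cell. -/
theorem eq_of_two_common_corners {t t' : Cell n} {j k j' k' : Fin 3} (hjk : j ≠ k)
    (hj : corner t j = corner t' j') (hk : corner t k = corner t' k') : t = t' := by
  have hi : ∀ i : Fin 6, i + 3 ≠ i + 1 ∧ i + 3 ≠ i - 1 ∧ i + 1 ≠ i - 1 := by decide
  have := hi t.2
  have h := (corner_eq_corner_iff t t' j j').1 hj
  have h' := (corner_eq_corner_iff t t' k k').1 hk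
  grind

/-! ### Decomposition of the network into edge-disjoint octahedra. -/

theorem octVertex_injective (t : Cell n) : Function.Injective (octVertex t) := by
  rintro (j | j) (k | k) h
  · simp only [octVertex, Sum.inl.injEq, Subtype.mk.injEq] at h
    rw [corner_injective t h]
  · simp [octVertex] at h
  · simp [octVertex] at h
  · simpa [octVertex] using h

theorem adj_octVertex {t : Cell n} {x y : Fin 3 ⊕ Fin 3} (h : octAdj x y) :
    (network n).Adj (octVertex t x) (octVertex t y) := by
  rcases x with j | j <;> rcases y with k | k
  · exact ⟨fun h' => h.1 (octVertex_injective t (congrArg Sum.inl h')), t, ⟨j, rfl⟩, k, rfl⟩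
  · exact ⟨j, fun h' => h.2 (congrArg Sum.inl h'), rfl⟩
  · exact ⟨k, fun h' => h.2 (congrArg Sum.inr h'.symm), rfl⟩
  · exact ⟨rfl, fun h' => h.1 (congrArg Sum.inr h')⟩

theorem exists_octVertex_of_adj {u v : Vertex n} (h : (network n).Adj u v) :
    ∃ t x y, octAdj x y ∧ octVertex t x = u ∧ octVertex t y = v := by
  rcases u with ⟨p, hp⟩ | ⟨t, j⟩ <;> rcases v with ⟨q, hq⟩ | ⟨t', k⟩
  · obtain ⟨hne, t, ⟨j, rfl⟩, k, rfl⟩ := h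
    refine ⟨t, .inl j, .inl k, ⟨?_, by simp⟩, rfl, rfl⟩
    rintro h
    cases h
    exact hne rfl
  · obtain ⟨j, hj, rfl⟩ := h
    exact ⟨t', .inl j, .inr k, ⟨by simp, by simpa using hj⟩, rfl, rfl⟩
  · obtain ⟨k, hk, rfl⟩ := h
    exact ⟨t, .inr j, .inl k, ⟨by simp, by simpa using hk.symm⟩, rfl, rfl⟩
  · obtain ⟨rfl, hjk⟩ := h
    exact ⟨t, .inr j, .inr k, ⟨by simpa using hjk, by simp⟩, rfl, rfl⟩

/-- Edge-disjointness: a new vertex determines its cell, and an edge without new vertices has two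
distinct corners as its ends, which also determine the cell. -/
theorem eq_of_octVertex_eq {t t' : Cell n} {x y x' y' : Fin 3 ⊕ Fin 3} (h : octAdj x y)
    (hx : octVertex t x = octVertex t' x') (hy : octVertex t y = octVertex t' y') :
    t = t' ∧ x = x' ∧ y = y' := by
  suffices ht : t = t' by
    subst ht
    exact ⟨rfl, octVertex_injective t hx, octVertex_injective t hy⟩
  rcases x with j | j <;> rcases x' with j' | j' <;> try simp [octVertex] at hx
  · rcases y with k | k <;> rcases y' with k' | k' <;> try simp [octVertex] at hy
    · exact eq_of_two_common_corners (fun e => h.1 (congrArg Sum.inl e)) hx hy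
    · exact hy.1
  · exact hx.1

/-- The neighbourhood of `u` is the disjoint union of its neighbourhoods in the octahedra through
`u`. General `M` lets one formula serve both degrees and real weights. -/
theorem sum_neighborFinset [DecidableRel (network n).Adj] {M : Type*} [AddCommMonoid M]
    (u : Vertex n) (g : Vertex n → M) :
    ∑ v ∈ (network n).neighborFinset u, g v =
      ∑ q : Cell n × (Fin 3 ⊕ Fin 3) with octVertex q.1 q.2 = u,
        ∑ y with octAdj q.2 y, g (octVertex q.1 y) := by
  rw [Finset.sum_sigma']
  symm
  refine Finset.sum_bij (fun q _ => octVertex q.1.1 q.2) ?_ ?_ ?_ fun _ _ => rfl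
  · rintro ⟨⟨t, x⟩, y⟩ h
    simp only [Finset.mem_sigma, Finset.mem_filter, Finset.mem_univ, true_and] at h
    rw [SimpleGraph.mem_neighborFinset, ← h.1]
    exact adj_octVertex h.2
  · rintro ⟨⟨t, x⟩, y⟩ h ⟨⟨t', x'⟩, y'⟩ h' e
    simp only [Finset.mem_sigma, Finset.mem_filter, Finset.mem_univ, true_and] at h h'
    obtain ⟨rfl, rfl, rfl⟩ := eq_of_octVertex_eq h.2 (h.1.trans h'.1.symm) e
    rfl
  · intro v hv
    rw [SimpleGraph.mem_neighborFinset] at hv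
    obtain ⟨t, x, y, hxy, hx, hy⟩ := exists_octVertex_of_adj hv
    exact ⟨⟨(t, x), y⟩, by simp [hx, hxy], hy⟩

theorem two_mul_edgeSum [DecidableRel (network n).Adj] (f : Vertex n → Vertex n → ℝ)
    (hf : ∀ u v, f u v = f v u) :
    2 * (network n).edgeSum f hf =
      ∑ t : Cell n, ∑ x, ∑ y with octAdj x y, f (octVertex t x) (octVertex t y) := by
  rw [SimpleGraph.two_mul_edgeSum]
  simp only [sum_neighborFinset]
  -- The pairs of a cell and a position in it are grouped by the vertex they represent.
  rw [← Fintype.sum_prod_type' (f := fun t x =>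
    ∑ y with octAdj x y, f (octVertex t x) (octVertex t y)),
    ← Finset.sum_fiberwise (s := Finset.univ)
      (g := fun q : Cell n × (Fin 3 ⊕ Fin 3) => octVertex q.1 q.2)]
  refine Finset.sum_congr rfl fun u _ => Finset.sum_congr rfl fun q hq => ?_
  rw [(Finset.mem_filter.1 hq).2]

/-! ### The octahedra passing through a given vertex. -/

/-- The next cell of the same hexagon, in cyclic order. -/
def next (t : Cell n) : Cell n := (t.1, t.2 + 1)

/-- The previous cell of the same hexagon, in cyclic order. -/
def prev (t : Cell n) : Cell n := (t.1, t.2 - 1)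

/-- The tip of the cell lies on a side common to two hexagons of the honeycomb. -/
def IsInner (t : Cell n) : Prop := t.1.1 + dir t.2 ∈ hexagons n

noncomputable instance (t : Cell n) : Decidable (IsInner t) := inferInstanceAs (Decidable (_ ∈ _))

/-- The other cell at the tip of an inner cell. -/
def opposite (t : Cell n) (h : IsInner t) : Cell n := (⟨t.1.1 + dir t.2, h⟩, t.2 + 3)

theorem octVertex_inr_eq_iff (t t' : Cell n) (j : Fin 3) (x : Fin 3 ⊕ Fin 3) :
    octVertex t' x = octVertex t (.inr j) ↔ (t', x) = (t, .inr j) := by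
  cases x <;> simp [octVertex]

theorem octVertex_inl_eq_iff (t t' : Cell n) (j : Fin 3) (x : Fin 3 ⊕ Fin 3) :
    octVertex t' x = octVertex t (.inl j) ↔ ∃ k, x = .inl k ∧ corner t j = corner t' k := by
  cases x <;> simp [octVertex, eq_comm]

theorem octVertex_tip_eq_iff (t t' : Cell n) (x : Fin 3 ⊕ Fin 3) :
    octVertex t' x = octVertex t (.inl 0) ↔
      (t', x) = (t, .inl 0) ∨ ∃ h : IsInner t, (t', x) = (opposite t h, .inl 0) := by
  obtain ⟨⟨c, hc⟩, i⟩ := t'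
  simp only [octVertex_inl_eq_iff, corner_eq_corner_iff]
  constructor
  · rintro ⟨k, rfl, h | ⟨rfl, rfl, -, rfl⟩ | h | h⟩
    · exact .inl (by rw [h.1, h.2])
    · exact .inr ⟨hc, rfl⟩
    · simp at h
    · simp at h
  · rintro (h | ⟨h, h'⟩)
    · cases h
      exact ⟨0, rfl, .inl ⟨rfl, rfl⟩⟩
    · cases h'
      exact ⟨0, rfl, .inr (.inl ⟨rfl, rfl, trivial, rfl⟩)⟩

theorem octVertex_one_eq_iff (t t' : Cell n) (x : Fin 3 ⊕ Fin 3) :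
    octVertex t' x = octVertex t (.inl 1) ↔
      (t', x) = (t, .inl 1) ∨ (t', x) = (next t, .inl 2) := by
  simp only [octVertex_inl_eq_iff, corner_eq_corner_iff, next]
  constructor
  · rintro ⟨k, rfl, ⟨rfl, rfl⟩ | h | ⟨rfl, -, rfl⟩ | h⟩
    · exact .inl rfl
    · simp at h
    · exact .inr rfl
    · simp at h
  · rintro (h | h) <;> cases h
    · exact ⟨1, rfl, .inl ⟨rfl, rfl⟩⟩
    · exact ⟨2, rfl, .inr (.inr (.inl ⟨rfl, trivial, rfl⟩))⟩

theorem octVertex_two_eq_iff (t t' : Cell n) (x : Fin 3 ⊕ Fin 3) :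
    octVertex t' x = octVertex t (.inl 2) ↔
      (t', x) = (t, .inl 2) ∨ (t', x) = (prev t, .inl 1) := by
  simp only [octVertex_inl_eq_iff, corner_eq_corner_iff, prev]
  constructor
  · rintro ⟨k, rfl, ⟨rfl, rfl⟩ | h | h | ⟨rfl, -, rfl⟩⟩
    · exact .inl rfl
    · simp at h
    · simp at h
    · exact .inr rfl
  · rintro (h | h) <;> cases h
    · exact ⟨2, rfl, .inl ⟨rfl, rfl⟩⟩
    · exact ⟨1, rfl, .inr (.inr (.inr ⟨rfl, trivial, rfl⟩))⟩

/-! ### Local computation of degrees and neighbour degree sums. -/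

theorem card_octAdj : ∀ x, (Finset.univ.filter (octAdj x)).card = 4 := by
  decide

section

variable {M : Type*} [AddCommMonoid M]

theorem sum_octAdj_inl_zero (g : Fin 3 ⊕ Fin 3 → M) :
    ∑ y with octAdj (.inl 0) y, g y =
      g (.inl 1) + g (.inl 2) + (g (.inr 1) + g (.inr 2)) := by
  simp only [Finset.sum_filter, Fintype.sum_sum_type, Fin.sum_univ_three]
  simp [octAdj]

theorem sum_octAdj_inl_one (g : Fin 3 ⊕ Fin 3 → M) :
    ∑ y with octAdj (.inl 1) y, g y =
      g (.inl 0) + g (.inl 2) + (g (.inr 0) + g (.inr 2)) := by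
  simp only [Finset.sum_filter, Fintype.sum_sum_type, Fin.sum_univ_three]
  simp [octAdj]

theorem sum_octAdj_inl_two (g : Fin 3 ⊕ Fin 3 → M) :
    ∑ y with octAdj (.inl 2) y, g y =
      g (.inl 0) + g (.inl 1) + (g (.inr 0) + g (.inr 1)) := by
  simp only [Finset.sum_filter, Fintype.sum_sum_type, Fin.sum_univ_three]
  simp [octAdj]

theorem sum_octAdj_inr_zero (g : Fin 3 ⊕ Fin 3 → M) :
    ∑ y with octAdj (.inr 0) y, g y =
      g (.inl 1) + g (.inl 2) + (g (.inr 1) + g (.inr 2)) := by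
  simp only [Finset.sum_filter, Fintype.sum_sum_type, Fin.sum_univ_three]
  simp [octAdj]

theorem sum_octAdj_inr_one (g : Fin 3 ⊕ Fin 3 → M) :
    ∑ y with octAdj (.inr 1) y, g y =
      g (.inl 0) + g (.inl 2) + (g (.inr 0) + g (.inr 2)) := by
  simp only [Finset.sum_filter, Fintype.sum_sum_type, Fin.sum_univ_three]
  simp [octAdj]

theorem sum_octAdj_inr_two (g : Fin 3 ⊕ Fin 3 → M) :
    ∑ y with octAdj (.inr 2) y, g y =
      g (.inl 0) + g (.inl 1) + (g (.inr 0) + g (.inr 1)) := by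
  simp only [Finset.sum_filter, Fintype.sum_sum_type, Fin.sum_univ_three]
  simp [octAdj]

variable [DecidableRel (network n).Adj] (t : Cell n) (g : Vertex n → M)

theorem sum_neighborFinset_inr (j : Fin 3) :
    ∑ v ∈ (network n).neighborFinset (octVertex t (.inr j)), g v =
      ∑ y with octAdj (.inr j) y, g (octVertex t y) := by
  simp only [sum_neighborFinset, octVertex_inr_eq_iff, Prod.mk.eta]
  rw [Finset.filter_eq' Finset.univ, if_pos (Finset.mem_univ _), Finset.sum_singleton]

theorem sum_neighborFinset_tip_of_not_isInner (h : ¬ IsInner t) :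
    ∑ v ∈ (network n).neighborFinset (octVertex t (.inl 0)), g v =
      ∑ y with octAdj (.inl 0) y, g (octVertex t y) := by
  simp only [sum_neighborFinset, octVertex_tip_eq_iff, h, IsEmpty.exists_iff, or_false,
    Prod.mk.eta]
  rw [Finset.filter_eq' Finset.univ, if_pos (Finset.mem_univ _), Finset.sum_singleton]

theorem sum_neighborFinset_tip_of_isInner (h : IsInner t) :
    ∑ v ∈ (network n).neighborFinset (octVertex t (.inl 0)), g v =
      ∑ y with octAdj (.inl 0) y, g (octVertex t y) +
      ∑ y with octAdj (.inl 0) y, g (octVertex (opposite t h) y) := by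
  -- The two representations of the tip differ because their directions differ by 3 modulo 6.
  have hne : (t, (.inl 0 : Fin 3 ⊕ Fin 3)) ≠ (opposite t h, .inl 0) := by
    intro e
    have := congrArg (fun q => q.1.2) e
    simp [opposite] at this
  rw [← Finset.sum_pair (f := fun q : Cell n × (Fin 3 ⊕ Fin 3) =>
    ∑ y with octAdj q.2 y, g (octVertex q.1 y)) hne, sum_neighborFinset]
  refine Finset.sum_congr ?_ fun _ _ => rfl
  ext q
  simp [octVertex_tip_eq_iff, h]

theorem sum_neighborFinset_one :
    ∑ v ∈ (network n).neighborFinset (octVertex t (.inl 1)), g v =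
      ∑ y with octAdj (.inl 1) y, g (octVertex t y) +
      ∑ y with octAdj (.inl 2) y, g (octVertex (next t) y) := by
  have hne : (t, (.inl 1 : Fin 3 ⊕ Fin 3)) ≠ (next t, .inl 2) := by simp
  rw [← Finset.sum_pair (f := fun q : Cell n × (Fin 3 ⊕ Fin 3) =>
    ∑ y with octAdj q.2 y, g (octVertex q.1 y)) hne, sum_neighborFinset]
  refine Finset.sum_congr ?_ fun _ _ => rfl
  ext q
  simp [octVertex_one_eq_iff]

theorem sum_neighborFinset_two :
    ∑ v ∈ (network n).neighborFinset (octVertex t (.inl 2)), g v =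
      ∑ y with octAdj (.inl 2) y, g (octVertex t y) +
      ∑ y with octAdj (.inl 1) y, g (octVertex (prev t) y) := by
  have hne : (t, (.inl 2 : Fin 3 ⊕ Fin 3)) ≠ (prev t, .inl 1) := by simp
  rw [← Finset.sum_pair (f := fun q : Cell n × (Fin 3 ⊕ Fin 3) =>
    ∑ y with octAdj q.2 y, g (octVertex q.1 y)) hne, sum_neighborFinset]
  refine Finset.sum_congr ?_ fun _ _ => rfl
  ext q
  simp [octVertex_two_eq_iff]

end

section

variable [DecidableRel (network n).Adj] (t : Cell n)

/-- Puts the degree in the form to which the local sum formulas apply, with `g` constantly 1. -/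
theorem degree_eq_sum (u : Vertex n) :
    (network n).degree u = ∑ _v ∈ (network n).neighborFinset u, 1 := by
  simp

/-- The degree of the tip of a cell. -/
noncomputable def tipDegree (t : Cell n) : ℕ := if IsInner t then 8 else 4

theorem degree_tip : (network n).degree (octVertex t (.inl 0)) = tipDegree t := by
  rw [degree_eq_sum, tipDegree]
  split_ifs with h
  · simp [sum_neighborFinset_tip_of_isInner t _ h, card_octAdj, -Finset.sum_const,
      ← Finset.card_eq_sum_ones]
  · simp [sum_neighborFinset_tip_of_not_isInner t _ h, card_octAdj, -Finset.sum_const,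
      ← Finset.card_eq_sum_ones]

theorem degree_one : (network n).degree (octVertex t (.inl 1)) = 8 := by
  rw [degree_eq_sum, sum_neighborFinset_one, ← Finset.card_eq_sum_ones,
    ← Finset.card_eq_sum_ones, card_octAdj, card_octAdj]

theorem degree_two : (network n).degree (octVertex t (.inl 2)) = 8 := by
  rw [degree_eq_sum, sum_neighborFinset_two, ← Finset.card_eq_sum_ones,
    ← Finset.card_eq_sum_ones, card_octAdj, card_octAdj]

theorem degree_inr (j : Fin 3) : (network n).degree (octVertex t (.inr j)) = 4 := by
  rw [degree_eq_sum, sum_neighborFinset_inr, ← Finset.card_eq_sum_ones, card_octAdj]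

theorem neighborDegreeSum_tip :
    (network n).neighborDegreeSum (octVertex t (.inl 0)) = if IsInner t then 48 else 24 := by
  rw [SimpleGraph.neighborDegreeSum]
  split_ifs with h
  · simp [sum_neighborFinset_tip_of_isInner t _ h, sum_octAdj_inl_zero, degree_one,
      degree_two, degree_inr]
  · simp [sum_neighborFinset_tip_of_not_isInner t _ h, sum_octAdj_inl_zero, degree_one,
      degree_two, degree_inr]

theorem neighborDegreeSum_one :
    (network n).neighborDegreeSum (octVertex t (.inl 1)) =
      32 + tipDegree t + tipDegree (next t) := by
  simp only [SimpleGraph.neighborDegreeSum, sum_neighborFinset_one, sum_octAdj_inl_one,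
    sum_octAdj_inl_two, degree_tip, degree_one, degree_two, degree_inr]
  ring

theorem neighborDegreeSum_two :
    (network n).neighborDegreeSum (octVertex t (.inl 2)) =
      32 + tipDegree t + tipDegree (prev t) := by
  simp only [SimpleGraph.neighborDegreeSum, sum_neighborFinset_two, sum_octAdj_inl_one,
    sum_octAdj_inl_two, degree_tip, degree_one, degree_two, degree_inr]
  ring

theorem neighborDegreeSum_inr_zero :
    (network n).neighborDegreeSum (octVertex t (.inr 0)) = 24 := by
  simp [SimpleGraph.neighborDegreeSum, sum_neighborFinset_inr, sum_octAdj_inr_zero,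
    degree_one, degree_two, degree_inr]

theorem neighborDegreeSum_inr_one :
    (network n).neighborDegreeSum (octVertex t (.inr 1)) = 16 + tipDegree t := by
  simp only [SimpleGraph.neighborDegreeSum, sum_neighborFinset_inr, sum_octAdj_inr_one,
    degree_tip, degree_two, degree_inr]
  ring

theorem neighborDegreeSum_inr_two :
    (network n).neighborDegreeSum (octVertex t (.inr 2)) = 16 + tipDegree t := by
  simp only [SimpleGraph.neighborDegreeSum, sum_neighborFinset_inr, sum_octAdj_inr_two,
    degree_tip, degree_one, degree_inr]
  ring

end

/-! ### Counting hexagons and cells by which neighbouring hexagons are present. -/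

theorem mem_hexagons {c : ℤ × ℤ} :
    c ∈ hexagons n ↔ ((-(n : ℤ) < c.1 ∧ c.1 < n) ∧ -(n : ℤ) < c.2 ∧ c.2 < n) ∧
      -(n : ℤ) < c.1 + c.2 ∧ c.1 + c.2 < n := by
  simp [hexagons]

/-- Whether the hexagon next to `c` in direction `i` belongs to the honeycomb. -/
noncomputable def hasNeighbor (n : ℕ) (c : ℤ × ℤ) (i : Fin 6) : Bool :=
  decide (c + dir i ∈ hexagons n)

/-- The rotation of the lattice by 60 degrees. -/
def rotate : ℤ × ℤ ≃ ℤ × ℤ where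
  toFun c := (-c.2, c.1 + c.2)
  invFun c := (c.1 + c.2, -c.1)
  left_inv c := by simp
  right_inv c := by simp

theorem rotate_add (c d : ℤ × ℤ) : rotate (c + d) = rotate c + rotate d := by
  ext <;> simp [rotate] <;> ring

theorem rotate_dir : ∀ i, rotate (dir i) = dir (i + 1) := by
  decide

theorem rotate_mem_hexagons (c : ℤ × ℤ) : rotate c ∈ hexagons n ↔ c ∈ hexagons n := by
  simp only [mem_hexagons, rotate, Equiv.coe_fn_mk]
  omega

theorem hasNeighbor_rotate (c : ℤ × ℤ) (i : Fin 6) :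
    hasNeighbor n (rotate c) (i + 1) = hasNeighbor n c i := by
  rw [hasNeighbor, hasNeighbor, ← rotate_dir, ← rotate_add]
  simp [rotate_mem_hexagons]

theorem sum_hexagons_hasNeighbor_succ (K : Bool → Bool → Bool → ℝ) (i : Fin 6) :
    ∑ c ∈ hexagons n,
        K (hasNeighbor n c (i + 1 - 1)) (hasNeighbor n c (i + 1)) (hasNeighbor n c (i + 1 + 1)) =
      ∑ c ∈ hexagons n,
        K (hasNeighbor n c (i - 1)) (hasNeighbor n c i) (hasNeighbor n c (i + 1)) := by
  symm
  refine Finset.sum_equiv rotate (fun c => (rotate_mem_hexagons c).symm) fun c _ => ?_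
  rw [← hasNeighbor_rotate c (i - 1), ← hasNeighbor_rotate c i, ← hasNeighbor_rotate c (i + 1),
    sub_add_cancel, add_sub_cancel_right]

/-- By rotational symmetry no direction is special; the right side is the case `i = 0`, since `0 - 1
= 5` in `Fin 6`. -/
theorem sum_hexagons_hasNeighbor (K : Bool → Bool → Bool → ℝ) (i : Fin 6) :
    ∑ c ∈ hexagons n,
        K (hasNeighbor n c (i - 1)) (hasNeighbor n c i) (hasNeighbor n c (i + 1)) =
      ∑ c ∈ hexagons n, K (hasNeighbor n c 5) (hasNeighbor n c 0) (hasNeighbor n c 1) := by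
  induction i using Fin.induction with
  | zero => rfl
  | succ i ih =>
    rw [← ih, ← Fin.coeSucc_eq_succ]
    exact sum_hexagons_hasNeighbor_succ K _

theorem sum_abs_Ioo (n : ℕ) :
    ∑ a ∈ Finset.Ioo (-(n : ℤ)) n, |a| = (n : ℤ) * (n - 1) := by
  induction n with
  | zero => simp
  | succ m ih =>
    -- For `m = 0` the two new endpoints `m` and `-m` coincide.
    rcases Nat.eq_zero_or_pos m with rfl | hm
    · rfl
    have : Finset.Ioo (-((m + 1 : ℕ) : ℤ)) ((m + 1 : ℕ) : ℤ) =
        insert (m : ℤ) (insert (-(m : ℤ)) (Finset.Ioo (-(m : ℤ)) m)) := by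
      ext a
      simp only [Finset.mem_Ioo, Finset.mem_insert]
      omega
    rw [this, Finset.sum_insert (by simp; omega), Finset.sum_insert (by simp), ih, abs_neg,
      abs_of_nonneg (Int.natCast_nonneg m)]
    push_cast
    ring

theorem card_hexagons (hn : 1 ≤ n) : ((hexagons n).card : ℤ) = 3 * (n : ℤ) ^ 2 - 3 * n + 1 := by
  -- Counting by columns: fixing the first coordinate `a` leaves an interval of second coordinates.
  have hcard : ∀ a ∈ Finset.Ioo (-(n : ℤ)) n,
      (((hexagons n).filter fun c => c.1 = a).card : ℤ) = 2 * n - 1 - |a| := by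
    intro a ha
    rw [Finset.mem_Ioo] at ha
    have : (hexagons n).filter (fun c => c.1 = a) =
        (Finset.Ioo (max (-(n : ℤ)) (-n - a)) (min (n : ℤ) (n - a))).image fun b => (a, b) := by
      ext ⟨x, y⟩
      simp only [Finset.mem_filter, mem_hexagons, Finset.mem_image, Finset.mem_Ioo, Prod.mk.injEq]
      constructor
      · rintro ⟨h, rfl⟩
        exact ⟨y, by omega, rfl, rfl⟩
      · rintro ⟨b, h, rfl, rfl⟩
        omega
    rw [this, Finset.card_image_of_injective _ (Prod.mk_right_injective a), Int.card_Ioo]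
    rcases abs_cases a with h | h <;> omega
  rw [Finset.card_eq_sum_card_fiberwise (f := Prod.fst) (t := Finset.Ioo (-(n : ℤ)) n)
    (fun c hc => by simpa using (mem_hexagons.1 hc).1.1)]
  push_cast
  rw [Finset.sum_congr rfl hcard, Finset.sum_sub_distrib, sum_abs_Ioo, Finset.sum_const,
    Int.card_Ioo, nsmul_eq_mul]
  have : (((n - -(n : ℤ) - 1).toNat : ℕ) : ℤ) = 2 * n - 1 := by omega
  rw [this]
  ring

theorem card_filter_hexagons_of_image (hn : 1 ≤ n) (P : ℤ × ℤ → Prop) [DecidablePred P]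
    (φ : ℕ → ℤ × ℤ) (hφ : Function.Injective φ)
    (h : ∀ c, c ∈ hexagons n ∧ P c ↔ ∃ k < n - 1, φ k = c) :
    (((hexagons n).filter P).card : ℝ) = n - 1 := by
  have : (hexagons n).filter P = (Finset.range (n - 1)).image φ := by
    ext c
    simp [h]
  rw [this, Finset.card_image_of_injective _ hφ, Finset.card_range, Nat.cast_sub hn, Nat.cast_one]

/-- The distribution of the neighbourhoods of the hexagons on three consecutive sides. -/
theorem sum_hexagons (hn : 1 ≤ n) (K : Bool → Bool → Bool → ℝ) :
    ∑ c ∈ hexagons n, K (hasNeighbor n c 5) (hasNeighbor n c 0) (hasNeighbor n c 1) =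
      K false false false + (n - 1) * (K false false true + K true false false +
        K true true false + K false true true) +
      (3 * n ^ 2 - 7 * n + 4) * K true true true := by
  -- The value with all neighbours present is corrected on five disjoint boundary pieces: the corner
  -- `(n - 1, 0)` and a piece of each of the four sides through which directions 5, 0, 1 can leave
  -- the honeycomb.
  have hK : ∀ c ∈ hexagons n,
      K (hasNeighbor n c 5) (hasNeighbor n c 0) (hasNeighbor n c 1) =
        K true true true
        + (if c = ((n : ℤ) - 1, 0) then K false false false - K true true true else 0)
        + (if c.1 = (n : ℤ) - 1 ∧ c.2 < 0 then K false false true - K true true true else 0)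
        + (if c.1 + c.2 = (n : ℤ) - 1 ∧ 0 < c.2 ∧ 0 ≤ c.1 then
            K true false false - K true true true else 0)
        + (if c.2 = (n : ℤ) - 1 ∧ c.1 < 0 then K true true false - K true true true else 0)
        + (if c.2 = 1 - (n : ℤ) ∧ c.1 < (n : ℤ) - 1 then
            K false true true - K true true true else 0) := by
    rintro ⟨a, b⟩ hc
    have h5 : hasNeighbor n (a, b) 5 = true ↔ (a + 1, b - 1) ∈ hexagons n := by
      rw [hasNeighbor, decide_eq_true_iff]
      rfl
    have h0 : hasNeighbor n (a, b) 0 = true ↔ (a + 1, b) ∈ hexagons n := by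
      simp [hasNeighbor, dir]
    have h1 : hasNeighbor n (a, b) 1 = true ↔ (a, b + 1) ∈ hexagons n := by
      simp [hasNeighbor, dir]
    simp only [mem_hexagons] at hc h5 h0 h1
    simp only [Prod.mk.injEq]
    -- The patterns true-false-true and false-true-false do not occur; `omega` refutes them along
    -- with the indicators that do not match the pattern.
    cases h5' : hasNeighbor n (a, b) 5 <;> cases h0' : hasNeighbor n (a, b) 0 <;>
      cases h1' : hasNeighbor n (a, b) 1 <;>
      simp only [h5', h0', h1', Bool.false_eq_true, true_iff, false_iff] at h5 h0 h1 <;>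
      split_ifs <;> first | (exfalso; omega) | ring
  have hcard : ((hexagons n).card : ℝ) = 3 * (n : ℝ) ^ 2 - 3 * n + 1 := by
    exact_mod_cast card_hexagons hn
  have hcorner : (((hexagons n).filter fun c => c = ((n : ℤ) - 1, 0)).card : ℝ) = 1 := by
    rw [Finset.filter_eq', if_pos (by rw [mem_hexagons]; omega)]
    simp
  have hside₁ := card_filter_hexagons_of_image hn (fun c => c.1 = (n : ℤ) - 1 ∧ c.2 < 0)
      (fun k => ((n : ℤ) - 1, -1 - (k : ℤ))) (fun k l h => by simpa using h) (by
    rintro ⟨a, b⟩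
    simp only [mem_hexagons, Prod.mk.injEq]
    exact ⟨fun h => ⟨(-1 - b).toNat, by omega⟩, by rintro ⟨k, h, rfl, rfl⟩; omega⟩)
  have hside₂ := card_filter_hexagons_of_image hn (fun c => c.1 + c.2 = (n : ℤ) - 1 ∧ 0 < c.2 ∧ 0 ≤ c.1)
      (fun k => ((k : ℤ), (n : ℤ) - 1 - k)) (fun k l h => by simpa using h) (by
    rintro ⟨a, b⟩
    simp only [mem_hexagons, Prod.mk.injEq]
    exact ⟨fun h => ⟨(a).toNat, by omega⟩, by rintro ⟨k, h, rfl, rfl⟩; omega⟩)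
  have hside₃ := card_filter_hexagons_of_image hn (fun c => c.2 = (n : ℤ) - 1 ∧ c.1 < 0)
      (fun k => (-1 - (k : ℤ), (n : ℤ) - 1)) (fun k l h => by simpa using h) (by
    rintro ⟨a, b⟩
    simp only [mem_hexagons, Prod.mk.injEq]
    exact ⟨fun h => ⟨(-1 - a).toNat, by omega⟩, by rintro ⟨k, h, rfl, rfl⟩; omega⟩)
  have hside₄ := card_filter_hexagons_of_image hn (fun c => c.2 = 1 - (n : ℤ) ∧ c.1 < (n : ℤ) - 1)
      (fun k => ((k : ℤ), 1 - (n : ℤ))) (fun k l h => by simpa using h) (by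
    rintro ⟨a, b⟩
    simp only [mem_hexagons, Prod.mk.injEq]
    exact ⟨fun h => ⟨(a).toNat, by omega⟩, by rintro ⟨k, h, rfl, rfl⟩; omega⟩)
  rw [Finset.sum_congr rfl hK]
  simp only [Finset.sum_add_distrib, ← Finset.sum_filter, Finset.sum_const, nsmul_eq_mul]
  rw [hcard, hcorner, hside₁, hside₂, hside₃, hside₄]
  ring

theorem sum_cells (hn : 1 ≤ n) (K : Bool → Bool → Bool → ℝ) :
    ∑ t : Cell n, K (decide (IsInner (prev t))) (decide (IsInner t))
        (decide (IsInner (next t))) =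
      6 * (K false false false + (n - 1) * (K false false true + K true false false +
        K true true false + K false true true) +
      (3 * n ^ 2 - 7 * n + 4) * K true true true) := by
  rw [← sum_hexagons hn, Fintype.sum_prod_type_right]
  have h : ∀ i : Fin 6, ∑ c : {c // c ∈ hexagons n},
      K (decide (IsInner (prev (c, i)))) (decide (IsInner (c, i)))
        (decide (IsInner (next (c, i)))) =
      ∑ c ∈ hexagons n, K (hasNeighbor n c 5) (hasNeighbor n c 0) (hasNeighbor n c 1) := by
    intro i
    rw [← sum_hexagons_hasNeighbor K i]
    exact Finset.sum_coe_sort (hexagons n) fun c =>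
      K (hasNeighbor n c (i - 1)) (hasNeighbor n c i) (hasNeighbor n c (i + 1))
  rw [Finset.sum_congr rfl fun i _ => h i]
  simp

/-! ### The two edge partitions. -/

/-- The degrees of the six vertices of a cell whose tip is inner if and only if `q`. -/
def cellDegree (q : Bool) : Fin 3 ⊕ Fin 3 → ℕ
  | .inl j => ![cond q 8 4, 8, 8] j
  | .inr _ => 4

/-- The neighbour degree sums of the six vertices of a cell; the Booleans tell whether the tips of
the previous cell, of the cell and of the next cell are inner. -/
def cellDegreeSum (p q r : Bool) : Fin 3 ⊕ Fin 3 → ℕ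
  | .inl j => ![cond q 48 24, 32 + cond q 8 4 + cond r 8 4, 32 + cond q 8 4 + cond p 8 4] j
  | .inr j => ![24, 16 + cond q 8 4, 16 + cond q 8 4] j

theorem tipDegree_eq_cond (t : Cell n) : tipDegree t = cond (decide (IsInner t)) 8 4 := by
  by_cases h : IsInner t <;> simp [tipDegree, h]

section

variable [DecidableRel (network n).Adj]

theorem degree_octVertex (t : Cell n) (x : Fin 3 ⊕ Fin 3) :
    (network n).degree (octVertex t x) = cellDegree (decide (IsInner t)) x := by
  rcases x with j | j
  · fin_cases j
    · exact (degree_tip t).trans (tipDegree_eq_cond t)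
    · exact degree_one t
    · exact degree_two t
  · exact degree_inr t j

theorem neighborDegreeSum_octVertex (t : Cell n) (x : Fin 3 ⊕ Fin 3) :
    (network n).neighborDegreeSum (octVertex t x) =
      cellDegreeSum (decide (IsInner (prev t))) (decide (IsInner t))
        (decide (IsInner (next t))) x := by
  rcases x with j | j <;> fin_cases j
  · refine (neighborDegreeSum_tip t).trans ?_
    by_cases h : IsInner t <;> simp [cellDegreeSum, h]
  · simpa [cellDegreeSum, tipDegree_eq_cond] using neighborDegreeSum_one t
  · simpa [cellDegreeSum, tipDegree_eq_cond] using neighborDegreeSum_two t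
  · exact neighborDegreeSum_inr_zero t
  · simpa [cellDegreeSum, tipDegree_eq_cond] using neighborDegreeSum_inr_one t
  · simpa [cellDegreeSum, tipDegree_eq_cond] using neighborDegreeSum_inr_two t

theorem sum_octAdj (g : Fin 3 ⊕ Fin 3 → Fin 3 ⊕ Fin 3 → ℝ) :
    ∑ x, ∑ y with octAdj x y, g x y =
      g (.inl 0) (.inl 1) + g (.inl 0) (.inl 2) + (g (.inl 0) (.inr 1) + g (.inl 0) (.inr 2)) +
      (g (.inl 1) (.inl 0) + g (.inl 1) (.inl 2) + (g (.inl 1) (.inr 0) + g (.inl 1) (.inr 2))) +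
      (g (.inl 2) (.inl 0) + g (.inl 2) (.inl 1) + (g (.inl 2) (.inr 0) + g (.inl 2) (.inr 1))) +
      (g (.inr 0) (.inl 1) + g (.inr 0) (.inl 2) + (g (.inr 0) (.inr 1) + g (.inr 0) (.inr 2)) +
      (g (.inr 1) (.inl 0) + g (.inr 1) (.inl 2) + (g (.inr 1) (.inr 0) + g (.inr 1) (.inr 2))) +
      (g (.inr 2) (.inl 0) + g (.inr 2) (.inl 1) +
        (g (.inr 2) (.inr 0) + g (.inr 2) (.inr 1)))) := by
  simp only [Fintype.sum_sum_type, Fin.sum_univ_three, sum_octAdj_inl_zero, sum_octAdj_inl_one,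
    sum_octAdj_inl_two, sum_octAdj_inr_zero, sum_octAdj_inr_one, sum_octAdj_inr_two]

/-- The edge partition of the network by the degrees of the end vertices. -/
theorem edgeSum_degree (hn : 1 ≤ n) (w : ℕ → ℕ → ℝ) (hw : ∀ a b, w a b = w b a) :
    (network n).edgeSum (fun u v => w ((network n).degree u) ((network n).degree v))
        (fun _ _ => hw _ _) =
      (54 * n ^ 2 - 30 * n + 6) * w 4 4 + (108 * n ^ 2 - 108 * n + 36) * w 4 8 +
        (54 * n ^ 2 - 78 * n + 30) * w 8 8 := by
  have h := two_mul_edgeSum (n := n)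
    (fun u v => w ((network n).degree u) ((network n).degree v)) (fun _ _ => hw _ _)
  simp only [degree_octVertex] at h
  have hc := sum_cells hn fun _ q _ =>
    ∑ x, ∑ y with octAdj x y, w (cellDegree q x) (cellDegree q y)
  -- Each edge was counted in both orientations, hence the division by 2.
  rw [h.trans hc |> eq_div_of_mul_eq two_ne_zero ∘ (mul_comm _ _).trans]
  simp only [sum_octAdj, cellDegree, Matrix.cons_val, cond_true, cond_false, hw 8 4]
  ring

/-- The edge partition of the network by the neighbour degree sums of the end vertices. -/
theorem edgeSum_neighborDegreeSum (hn : 1 ≤ n) (w : ℕ → ℕ → ℝ) (hw : ∀ a b, w a b = w b a) :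
    (network n).edgeSum
        (fun u v => w ((network n).neighborDegreeSum u) ((network n).neighborDegreeSum v))
        (fun _ _ => hw _ _) =
      (12 * n - 6) * w 20 20 + (48 * n - 24) * w 20 24 + 12 * n * w 20 40 +
        12 * (n - 1) * w 20 44 + (54 * n ^ 2 - 90 * n + 36) * w 24 24 + 24 * n * w 24 40 +
        48 * (n - 1) * w 24 44 + (108 * n ^ 2 - 204 * n + 96) * w 24 48 + 6 * w 40 40 +
        12 * (n - 1) * w 40 44 + 24 * (n - 1) * w 44 48 +
        (54 * n ^ 2 - 114 * n + 60) * w 48 48 := by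
  have h := two_mul_edgeSum (n := n)
    (fun u v => w ((network n).neighborDegreeSum u) ((network n).neighborDegreeSum v))
    (fun _ _ => hw _ _)
  simp only [neighborDegreeSum_octVertex] at h
  have hc := sum_cells hn fun p q r =>
    ∑ x, ∑ y with octAdj x y, w (cellDegreeSum p q r x) (cellDegreeSum p q r y)
  rw [h.trans hc |> eq_div_of_mul_eq two_ne_zero ∘ (mul_comm _ _).trans]
  simp only [sum_octAdj, cellDegreeSum, Matrix.cons_val, cond_true, cond_false, Nat.reduceAdd,
    hw 24 20, hw 40 20, hw 44 20, hw 40 24, hw 44 24, hw 48 24, hw 44 40, hw 48 44]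
  ring

end

end DPOH

/-! ### Evaluation of the radicals and of the four indices. -/

theorem Real.sqrt_eq_sqrt_div {x k m : ℝ} (hm : 0 < m) (h : x = k / m ^ 2) : √x = √k / m := by
  rw [h, Real.sqrt_div' _ (sq_nonneg m), Real.sqrt_sq hm.le]

theorem Real.sqrt_eq_mul_sqrt {x k m : ℝ} (hm : 0 ≤ m) (h : x = m ^ 2 * k) : √x = m * √k := by
  rw [h, Real.sqrt_mul (sq_nonneg m), Real.sqrt_sq hm]

theorem theorem9 (n : ℕ) {V : Type*} [Fintype V] [DecidableEq V]
    (G : SimpleGraph V) [DecidableRel G.Adj] (hG : Nonempty (G ≃g DPOH.network n)) :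
    (1 ≤ n →
      G.ABC = 1 / 8 * (72 * √5 * (1 - 3 * n + 3 * n ^ 2)
        + 6 * √14 * (5 - 13 * n + 9 * n ^ 2)
        + 12 * √6 * (1 - 5 * n + 9 * n ^ 2)) ∧
      G.GA = 12 * (3 + 2 * √2) * (1 - 3 * n + 3 * n ^ 2)) ∧
    (3 ≤ n →
      G.ABC4 = 1 / 440 * (66 * √78 + 5280 * (-1 + n) + 120 * √330 * (-1 + n)
        + 24 * √2255 * (-1 + n) + 24 * √3410 * (-1 + n)
        + 264 * √29 * n + 88 * √930 * n
        + 528 * √35 * (-1 + 2 * n) + 132 * √38 * (-1 + 2 * n)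
        + 330 * √46 * (2 - 5 * n + 3 * n ^ 2)
        + 55 * √94 * (10 - 19 * n + 9 * n ^ 2)
        + 220 * √35 * (8 - 17 * n + 9 * n ^ 2)) ∧
      G.GA5 = 96 + 96 / 23 * √33 * (-1 + n) + 3 / 2 * √55 * (-1 + n)
        + 96 / 17 * √66 * (-1 + n) + 8 / 7 * √110 * (-1 + n)
        - 192 * n + 8 * √2 * n + 6 * √15 * n + 108 * n ^ 2
        + 48 / 11 * √30 * (-1 + 2 * n) + 8 * √2 * (8 - 17 * n + 9 * n ^ 2)) := by
  classical
  obtain ⟨e⟩ := hG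
  have hABC : ∀ a b : ℕ, √(((a : ℝ) + b - 2) / ((a : ℝ) * b)) =
      √(((b : ℝ) + a - 2) / ((b : ℝ) * a)) := fun a b => by
    rw [add_comm (a : ℝ), mul_comm (a : ℝ)]
  have hGA : ∀ a b : ℕ, 2 * √((a : ℝ) * b) / ((a : ℝ) + b) =
      2 * √((b : ℝ) * a) / ((b : ℝ) + a) := fun a b => by
    rw [add_comm (a : ℝ), mul_comm (a : ℝ)]
  refine ⟨fun hn => ⟨?_, ?_⟩, fun hn => ⟨?_, ?_⟩⟩
  · have h := DPOH.edgeSum_degree hn (fun a b => √(((a : ℝ) + b - 2) / ((a : ℝ) * b))) hABC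
    refine (e.edgeSum_eq fun u v => by simp only [e.degree_eq]).trans (h.trans ?_)
    push_cast
    -- Each `m` makes the denominator a perfect square and leaves under the root the integer `k` of
    -- the stated formula.
    rw [Real.sqrt_eq_sqrt_div (x := (4 + 4 - 2) / (4 * 4)) (k := 6) (m := 4)
        (by norm_num) (by norm_num),
      Real.sqrt_eq_sqrt_div (x := (4 + 8 - 2) / (4 * 8)) (k := 5) (m := 4)
        (by norm_num) (by norm_num),
      Real.sqrt_eq_sqrt_div (x := (8 + 8 - 2) / (8 * 8)) (k := 14) (m := 8)
        (by norm_num) (by norm_num)]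
    ring
  · have h := DPOH.edgeSum_degree hn (fun a b => 2 * √((a : ℝ) * b) / ((a : ℝ) + b)) hGA
    refine (e.edgeSum_eq fun u v => by simp only [e.degree_eq]).trans (h.trans ?_)
    push_cast
    rw [Real.sqrt_mul_self (by norm_num : (0 : ℝ) ≤ 4),
      Real.sqrt_eq_mul_sqrt (x := 4 * 8) (k := 2) (m := 4) (by norm_num) (by norm_num),
      Real.sqrt_mul_self (by norm_num : (0 : ℝ) ≤ 8)]
    ring
  · have h := DPOH.edgeSum_neighborDegreeSum (by omega : 1 ≤ n)
      (fun a b => √(((a : ℝ) + b - 2) / ((a : ℝ) * b))) hABC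
    refine (e.edgeSum_eq fun u v => by simp only [e.neighborDegreeSum_eq]).trans (h.trans ?_)
    push_cast
    rw [Real.sqrt_eq_sqrt_div (x := (20 + 20 - 2) / (20 * 20)) (k := 38) (m := 20)
        (by norm_num) (by norm_num),
      Real.sqrt_eq_sqrt_div (x := (20 + 24 - 2) / (20 * 24)) (k := 35) (m := 20)
        (by norm_num) (by norm_num),
      Real.sqrt_eq_sqrt_div (x := (20 + 40 - 2) / (20 * 40)) (k := 29) (m := 20)
        (by norm_num) (by norm_num),
      Real.sqrt_eq_sqrt_div (x := (20 + 44 - 2) / (20 * 44)) (k := 3410) (m := 220)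
        (by norm_num) (by norm_num),
      Real.sqrt_eq_sqrt_div (x := (24 + 24 - 2) / (24 * 24)) (k := 46) (m := 24)
        (by norm_num) (by norm_num),
      Real.sqrt_eq_sqrt_div (x := (24 + 40 - 2) / (24 * 40)) (k := 930) (m := 120)
        (by norm_num) (by norm_num),
      -- Here 66/1056 = 1/16 is a rational square, the source of the radical-free term `5280 * (-1 +
      -- n)`.
      Real.sqrt_eq_sqrt_div (x := (24 + 44 - 2) / (24 * 44)) (k := 1) (m := 4)
        (by norm_num) (by norm_num),
      Real.sqrt_eq_sqrt_div (x := (24 + 48 - 2) / (24 * 48)) (k := 35) (m := 24)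
        (by norm_num) (by norm_num),
      Real.sqrt_eq_sqrt_div (x := (40 + 40 - 2) / (40 * 40)) (k := 78) (m := 40)
        (by norm_num) (by norm_num),
      Real.sqrt_eq_sqrt_div (x := (40 + 44 - 2) / (40 * 44)) (k := 2255) (m := 220)
        (by norm_num) (by norm_num),
      Real.sqrt_eq_sqrt_div (x := (44 + 48 - 2) / (44 * 48)) (k := 330) (m := 88)
        (by norm_num) (by norm_num),
      Real.sqrt_eq_sqrt_div (x := (48 + 48 - 2) / (48 * 48)) (k := 94) (m := 48)
        (by norm_num) (by norm_num), Real.sqrt_one]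
    ring
  · have h := DPOH.edgeSum_neighborDegreeSum (by omega : 1 ≤ n)
      (fun a b => 2 * √((a : ℝ) * b) / ((a : ℝ) + b)) hGA
    refine (e.edgeSum_eq fun u v => by simp only [e.neighborDegreeSum_eq]).trans (h.trans ?_)
    push_cast
    rw [Real.sqrt_mul_self (by norm_num : (0 : ℝ) ≤ 20),
      Real.sqrt_eq_mul_sqrt (x := 20 * 24) (k := 30) (m := 4) (by norm_num) (by norm_num),
      Real.sqrt_eq_mul_sqrt (x := 20 * 40) (k := 2) (m := 20) (by norm_num) (by norm_num),
      Real.sqrt_eq_mul_sqrt (x := 20 * 44) (k := 55) (m := 4) (by norm_num) (by norm_num),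
      Real.sqrt_mul_self (by norm_num : (0 : ℝ) ≤ 24),
      Real.sqrt_eq_mul_sqrt (x := 24 * 40) (k := 15) (m := 8) (by norm_num) (by norm_num),
      Real.sqrt_eq_mul_sqrt (x := 24 * 44) (k := 66) (m := 4) (by norm_num) (by norm_num),
      Real.sqrt_eq_mul_sqrt (x := 24 * 48) (k := 2) (m := 24) (by norm_num) (by norm_num),
      Real.sqrt_mul_self (by norm_num : (0 : ℝ) ≤ 40),
      Real.sqrt_eq_mul_sqrt (x := 40 * 44) (k := 110) (m := 4) (by norm_num) (by norm_num),
      Real.sqrt_eq_mul_sqrt (x := 44 * 48) (k := 33) (m := 8) (by norm_num) (by norm_num),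
      Real.sqrt_mul_self (by norm_num : (0 : ℝ) ≤ 48)]
    ring
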